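/- Let $k\ge 2$, $\mathcal X=\{1,\dots,k\}$, $h:\mathcal X\to\mathbb R^d$, $\alpha\in\mathbb R^d$, and let $Q$ be a probability mass function on $\mathcal X$ with $Q(x)>0$ for all $x$. Let $E$ be the set of strictly positive probability mass functions $P$ on $\mathcal X$ with $\sum_x P(x)h(x)=\alpha$, and let $P^*\in E$ be the information projection of $Q$, i.e. a minimizer over $P\in E$ of $D(P\|Q)=\sum_x P(x)\log\frac{P(x)}{Q(x)}$; put $p^*_{\min}=\min_x P^*(x)$. Let $\mathsf T^*=\{v\in\mathbb R^k:\sum_x v_x=0,\ \sum_x v_x h(x)=0\}$, assumed $\neq\{0\}$, and let $\lambda_{\min}(H^*)>0$ be the smallest eigenvalue of the operator $H^*=\Pi\,\mathrm{diag}(1/P^*)|_{\mathsf T^*}$ on $\mathsf T^*$, where $\Pi$ is the Euclidean orthogonal projection onto $\mathsf T^*$. Let $X_1,X_2,\dots$ be i.i.d. with law $Q$, let $P_n=\frac1n\sum_{i\le n}\delta_{X_i}$, and let $E_n$ be the set of elements of $E$ that are empirical distributions of $n$ points of $\mathcal X$. For $n$ with $E_n\ne\emptyset$ let $\mu_{n,m}=\mathcal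 L(X_{1:m}\mid P_n\in E_n)$; for $m\le n$ this is the mixture $$\mu_{n,m}(x_{1:m})=\sum_{P\in E_n}\Pr(X_{1:m}=x_{1:m}\mid P_n=P)\,\Pr(P_n=P\mid P_n\in E_n),$$ whose first factor is sampling without replacement from a population of size $n$ with composition $P$. Assume that $P^*$ is in the closure of $\bigcup_n E_n$ (this holds, for instance, whenever $h$ and $\alpha$ have rational coordinates). Then there are constants $C_{\mathrm{geo}},C'_{\mathrm{geo}}>0$ that depend only on $(k,d,p^*_{\min})$ such that for every sequence $m=m_n$ of natural numbers with $m=o\big(\sqrt{n\,\lambda_{\min}(H^*)/\log n}\big)$ as $n\to\infty$, there is a sequence $r_n=o(n^{-1/2})$ such that, for all $n$ with $E_n\neq\emptyset$, $$\|\mu_{n,m}-(P^*)^{\otimes m}\|_{\mathrm{TV}}\le C_{\mathrm{geo}}\,m\sqrt{\frac{\log n}{n\,\lambda_{\min}(H^*)}}+C'_{\mathrm{geo}}\,\frac{m^2}{n\,p^*_{\min}}+r_n ,$$ where $\|\mu-\nu\|_{\mathrm{TV}}=\sup_A|\mu(A)-\nu(A)|$. -/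

import Mathlib

open MeasureTheory ProbabilityTheory Filter Asymptotics

noncomputable section

namespace PredictiveCollapse

/-- The open probability simplex on `k` points. -/
def openSimplex (k : ℕ) : Set (Fin k → ℝ) :=
  {P | (∀ x, 0 < P x) ∧ ∑ x, P x = 1}

/-- The laws in the open simplex under which the feature map `h` has mean `α`. -/
def feasible {k d : ℕ} (h : Fin k → Fin d → ℝ) (α : Fin d → ℝ) : Set (Fin k → ℝ) :=
  {P | P ∈ openSimplex k ∧ ∑ x, P x • h x = α}

/-- The empirical distribution of a sample of size `n` (the zero vector if `n = 0`). -/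
def empirical {k n : ℕ} (x : Fin n → Fin k) : Fin k → ℝ :=
  fun a => ((Finset.univ.filter fun i => x i = a).card : ℝ) / n

/-- The feasible laws that are empirical distributions of samples of size `n`. -/
def feasibleTypes {k d : ℕ} (h : Fin k → Fin d → ℝ) (α : Fin d → ℝ) (n : ℕ) :
    Set (Fin k → ℝ) :=
  {P | P ∈ feasible h α ∧ ∃ x : Fin n → Fin k, empirical x = P}

/-- The Kullback–Leibler divergence of strictly positive laws on `k` points. -/
def kl {k : ℕ} (P Q : Fin k → ℝ) : ℝ :=
  ∑ x, P x * Real.log (P x / Q x)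

/-- `P` is an information projection of `Q` onto the set `E`: it minimizes `kl · Q` over `E`. -/
def IsInfoProjection {k : ℕ} (Q : Fin k → ℝ) (E : Set (Fin k → ℝ)) (P : Fin k → ℝ) : Prop :=
  P ∈ E ∧ ∀ P' ∈ E, kl P Q ≤ kl P' Q

/-- The space of `v` with `∑ x, v x = 0` and `∑ x, v x • h x = 0`. -/
def tangentSpace {k d : ℕ} (h : Fin k → Fin d → ℝ) :
    Submodule ℝ (EuclideanSpace ℝ (Fin k)) where
  carrier := {v | ∑ x, v x = 0 ∧ ∑ x, v x • h x = 0}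
  zero_mem' := by simp
  add_mem' := by
    rintro v w ⟨hv, hv'⟩ ⟨hw, hw'⟩
    constructor
    · simp [Finset.sum_add_distrib, hv, hw]
    · simp [add_smul, Finset.sum_add_distrib, hv', hw']
  smul_mem' := by
    rintro c v ⟨hv, hv'⟩
    constructor
    · simp [← Finset.mul_sum, hv]
    · simp [mul_smul, ← Finset.smul_sum, hv']

/-- The linear map `diag (1 / P)` on Euclidean `k`-space. -/
def diagInv {k : ℕ} (P : Fin k → ℝ) :
    EuclideanSpace ℝ (Fin k) →ₗ[ℝ] EuclideanSpace ℝ (Fin k) :=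
  Matrix.toEuclideanLin (Matrix.diagonal fun x => 1 / P x)

/-- The projected Hessian: `diag (1 / P)` compressed to the tangent space by the
orthogonal projection. In an orthonormal basis `V` of the tangent space this is
the matrix `Vᵀ diag (1 / P) V`. -/
def projHessian {k d : ℕ} (h : Fin k → Fin d → ℝ) (P : Fin k → ℝ) :
    Module.End ℝ (tangentSpace h) :=
  (tangentSpace h).orthogonalProjectionOnto.toLinearMap ∘ₗ diagInv P ∘ₗ (tangentSpace h).subtype

/-- The smallest eigenvalue of an endomorphism of a real vector space (here always a symmetric
endomorphism of a nonzero finite-dimensional space, so that it is attained). -/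
def lambdaMin {V : Type*} [AddCommGroup V] [Module ℝ V] (T : Module.End ℝ V) : ℝ :=
  sInf {μ : ℝ | T.HasEigenvalue μ}

/-- The smallest mass `min_x P x`. -/
def minMass {k : ℕ} (P : Fin k → ℝ) : ℝ :=
  ⨅ x, P x

/-- The measure on `k` points with mass function `P`. -/
def law {k : ℕ} (P : Fin k → ℝ) : Measure (Fin k) :=
  ∑ x, ENNReal.ofReal (P x) • Measure.dirac x

/-- The event that the empirical distribution of the first `n` observations `X 0, …, X (n - 1)`
is feasible. -/
def feasibleEvent {Ω : Type*} {k d : ℕ} (X : ℕ → Ω → Fin k)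
    (h : Fin k → Fin d → ℝ) (α : Fin d → ℝ) (n : ℕ) : Set Ω :=
  {ω | empirical (fun i : Fin n => X i ω) ∈ feasibleTypes h α n}

/-- The law of the first `m` observations, conditionally on the event that the empirical
distribution of the first `n` observations is feasible. For `m ≤ n`, by conditioning further on
the empirical distribution, this is the mixture over the feasible types `P` of sampling `m` times
without replacement from the `n`-point population of type `P`, with weights the conditional
probabilities of the types given feasibility. -/
def predictiveLaw {Ω : Type*} [MeasurableSpace Ω] (Pr : Measure Ω) {k d : ℕ} (X : ℕ → Ω → Fin k)
    (h : Fin k → Fin d → ℝ) (α : Fin d → ℝ) (n m : ℕ) : Measure (Fin m → Fin k) :=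
  (ProbabilityTheory.cond Pr (feasibleEvent X h α n)).map fun ω i => X i ω

/-- The total variation distance `sup_s |μ s - ν s|` of probability measures (`s` measurable). -/
def tvDist {S : Type*} [MeasurableSpace S] (μ ν : Measure S) : ℝ :=
  ⨆ s : {s : Set S // MeasurableSet s}, |μ.real s - ν.real s|

/-- `X 0, X 1, …` are independent with common mass function `Q`. -/
def IsIIDSample {Ω : Type*} [MeasurableSpace Ω] (Pr : Measure Ω) {k : ℕ} (X : ℕ → Ω → Fin k)
    (Q : Fin k → ℝ) : Prop :=
  (∀ i, Measurable (X i)) ∧ iIndepFun X Pr ∧ ∀ i, Pr.map (X i) = law Q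

end PredictiveCollapse

end
open PredictiveCollapse

/-!
Stationarity of `kl · Q` at the information projection `P` makes `log (P / Q)` orthogonal to the
tangent space, so on samples with feasible empirical distribution the product masses of `Q` and `P`
are proportional, and the predictive law may be computed from `P` instead of `Q`. Three errors
remain.

* The conditioned sample is exchangeable, so its first `m` coordinates differ from `m` independent
  draws from its empirical distribution only through collisions among the draws: `m ^ 2 / n`.
* A type `R` with `kl R P ≤ δ` satisfies `∑ a, |R a - P a| ≤ 2 √δ`, which costs `m * (2 * √δ)`.
* The types with `kl R P > δ` have total mass at most `(n + 1) ^ k * exp (-n δ)`. Rounding in the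
  lattice of integral tangent vectors produces a feasible type at distance `O (1 / n)` from `P`,
  hence of divergence `O (1 / n ^ 2)`, and it alone has mass at least a constant times
  `(n + 1) ^ (-k)`.

With `δ = (2 k + 1) log n / n` the last error is `O (1 / n)`. Finally `λ_min ≤ 1 / p_min`, so that
`√(log n / n)` is at most `√(log n / (n λ_min)) / √p_min`.
-/

namespace PredictiveCollapse

section Types

variable {ι A : Type*} [Fintype ι] [DecidableEq A]

/-- The number of occurrences of the letter `a` in the sample `x`; divided by the sample size it
is the empirical distribution. -/
def occurrences (x : ι → A) (a : A) : ℕ :=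
  (Finset.univ.filter fun i => x i = a).card

lemma occurrences_le_card (x : ι → A) (a : A) : occurrences x a ≤ Fintype.card ι :=
  Finset.card_le_univ _

lemma exists_comp_perm_eq_iff (x y : ι → A) :
    (∃ σ : Equiv.Perm ι, x ∘ σ = y) ↔ occurrences y = occurrences x := by
  constructor
  · rintro ⟨σ, rfl⟩
    funext a
    exact Finset.card_bij (fun i _ => σ i) (by simp) (by simp) fun j hj =>
      ⟨σ.symm j, by simpa using hj, by simp⟩
  · intro h
    have hcard (a : A) : Fintype.card {i // y i = a} = Fintype.card {i // x i = a} := by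
      rw [Fintype.card_subtype, Fintype.card_subtype]
      exact congrFun h a
    exact ⟨Equiv.ofFiberEquiv fun a => Fintype.equivOfCardEq (hcard a),
      funext fun i => Equiv.ofFiberEquiv_map _ i⟩

variable [Fintype A]

lemma sum_occurrences (x : ι → A) : ∑ a, occurrences x a = Fintype.card ι :=
  (Finset.card_eq_sum_card_fiberwise fun _ _ => Finset.mem_coe.2 (Finset.mem_univ _)).symm

lemma prod_comp_eq_prod_pow_occurrences {M : Type*} [CommMonoid M] (f : A → M) (x : ι → A) :
    ∏ i, f (x i) = ∏ a, f a ^ occurrences x a := by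
  rw [← Finset.prod_fiberwise' Finset.univ x f]
  simp only [Finset.prod_const, occurrences]

variable [DecidableEq ι]

/-- The type class of the sample `x`: the samples in which every letter occurs as often as
in `x`. -/
def typeClass (x : ι → A) : Finset (ι → A) :=
  Finset.univ.filter fun y => occurrences y = occurrences x

@[simp]
lemma mem_typeClass {x y : ι → A} : y ∈ typeClass x ↔ occurrences y = occurrences x := by
  simp [typeClass]

-- The permutations `σ` with `x ∘ σ = y` form a coset of the stabilizer of `x`.
lemma card_typeClass_mul_prod_factorial (x : ι → A) :
    (typeClass x).card * ∏ a, (occurrences x a).factorial = (Fintype.card ι).factorial := by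
  have hstab : (Finset.univ.filter fun σ : Equiv.Perm ι => x ∘ σ = x).card =
      ∏ a, (occurrences x a).factorial := by
    simp only [← Fintype.card_subtype, DomMulAct.stabilizer_card, occurrences]
  have hcoset : ∀ y ∈ typeClass x,
      (Finset.univ.filter fun σ : Equiv.Perm ι => x ∘ σ = y).card =
        ∏ a, (occurrences x a).factorial := by
    intro y hy
    obtain ⟨τ, rfl⟩ := (exists_comp_perm_eq_iff x y).2 (mem_typeClass.1 hy)
    rw [← hstab]
    refine Finset.card_bij' (fun σ _ => σ * τ⁻¹) (fun σ _ => σ * τ) ?_ ?_ (by simp) (by simp)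
    · intro σ hσ
      have hσ' : x ∘ σ = x ∘ τ := by simpa using hσ
      simpa [Equiv.Perm.coe_mul, ← Function.comp_assoc, hσ'] using
        funext fun i => by simp
    · intro σ hσ
      have hσ' : x ∘ σ = x := by simpa using hσ
      simp [Equiv.Perm.coe_mul, ← Function.comp_assoc, hσ']
  rw [← Fintype.card_perm, ← Finset.card_univ, Finset.card_eq_sum_card_fiberwise
    (f := fun σ : Equiv.Perm ι => x ∘ σ) (t := typeClass x)
    fun σ _ => mem_typeClass.2 ((exists_comp_perm_eq_iff x _).1 ⟨σ, rfl⟩),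
    Finset.sum_congr rfl hcoset, Finset.sum_const, smul_eq_mul]

lemma card_image_occurrences_le :
    (Finset.univ.image (occurrences : (ι → A) → A → ℕ)).card ≤
      (Fintype.card ι + 1) ^ Fintype.card A := by
  calc (Finset.univ.image (occurrences : (ι → A) → A → ℕ)).card
      ≤ (Fintype.piFinset fun _ : A => Finset.range (Fintype.card ι + 1)).card := by
        refine Finset.card_le_card (Finset.image_subset_iff.2 fun x _ => ?_)
        simpa only [Fintype.mem_piFinset, Finset.mem_range, Nat.lt_succ_iff] using
          occurrences_le_card x
    _ = (Fintype.card ι + 1) ^ Fintype.card A := by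
        rw [Fintype.card_piFinset, Finset.prod_const, Finset.card_univ, Finset.card_range]

lemma sum_le_pow_mul_of_sum_typeClass_le {f : (ι → A) → ℝ} {b : ℝ} (S : Finset (ι → A))
    (hb : 0 ≤ b) (h : ∀ x ∈ S, ∑ y ∈ S with y ∈ typeClass x, f y ≤ b) :
    ∑ x ∈ S, f x ≤ ((Fintype.card ι : ℝ) + 1) ^ Fintype.card A * b := by
  have hcard : ((S.image occurrences).card : ℝ) ≤
      ((Fintype.card ι : ℝ) + 1) ^ Fintype.card A := by
    exact_mod_cast (Finset.card_le_card (Finset.image_subset_image (Finset.subset_univ S))).trans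
      card_image_occurrences_le
  calc ∑ x ∈ S, f x = ∑ c ∈ S.image occurrences, ∑ y ∈ S with occurrences y = c, f y :=
        (Finset.sum_fiberwise_of_maps_to (fun _ => Finset.mem_image_of_mem _) f).symm
    _ ≤ ∑ _c ∈ S.image occurrences, b := by
        refine Finset.sum_le_sum fun c hc => ?_
        obtain ⟨x, hx, rfl⟩ := Finset.mem_image.1 hc
        simpa only [mem_typeClass] using h x hx
    _ ≤ ((Fintype.card ι : ℝ) + 1) ^ Fintype.card A * b := by
        rw [Finset.sum_const, nsmul_eq_mul]
        gcongr

end Types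

section ProductMass

lemma factorial_mul_pow_le (a b : ℕ) : a.factorial * a ^ b ≤ b.factorial * a ^ a := by
  rcases le_total a b with hab | hba
  · calc a.factorial * a ^ b = a.factorial * a ^ (b - a) * a ^ a := by
          rw [mul_assoc, ← pow_add, Nat.sub_add_cancel hab]
      _ ≤ b.factorial * a ^ a :=
          Nat.mul_le_mul_right _ (Nat.factorial_mul_pow_sub_le_factorial hab)
  · have hdesc : a.factorial = b.factorial * a.descFactorial (a - b) := by
      simpa only [Nat.sub_sub_self hba] using
        (Nat.factorial_mul_descFactorial (Nat.sub_le a b)).symm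
    calc a.factorial * a ^ b = b.factorial * a.descFactorial (a - b) * a ^ b :=
          congrArg (· * a ^ b) hdesc
      _ ≤ b.factorial * a ^ (a - b) * a ^ b :=
          Nat.mul_le_mul_right _ (Nat.mul_le_mul_left _ (Nat.descFactorial_le_pow _ _))
      _ = b.factorial * a ^ a := by rw [mul_assoc, ← pow_add, Nat.sub_add_cancel hba]

variable {ι A : Type*} [Fintype ι]

/-- The mass of a finite set of samples under the product of the mass function `P`. -/
def productMass (P : A → ℝ) (s : Finset (ι → A)) : ℝ :=
  ∑ y ∈ s, ∏ i, P (y i)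

lemma productMass_nonneg {P : A → ℝ} (hP : 0 ≤ P) (s : Finset (ι → A)) : 0 ≤ productMass P s :=
  Finset.sum_nonneg fun _ _ => Finset.prod_nonneg fun _ _ => hP _

lemma productMass_mono {P : A → ℝ} (hP : 0 ≤ P) {s t : Finset (ι → A)} (hst : s ⊆ t) :
    productMass P s ≤ productMass P t :=
  Finset.sum_le_sum_of_subset_of_nonneg hst fun _ _ _ => Finset.prod_nonneg fun _ _ => hP _

lemma productMass_smul (c : ℝ) (P : A → ℝ) (s : Finset (ι → A)) :
    productMass (c • P) s = c ^ Fintype.card ι * productMass P s := by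
  simp only [productMass, Pi.smul_apply, smul_eq_mul, Finset.prod_mul_distrib, Finset.prod_const,
    Finset.card_univ, Finset.mul_sum]

variable [Fintype A]

lemma productMass_univ [DecidableEq ι] (P : A → ℝ) :
    productMass P (Finset.univ : Finset (ι → A)) = (∑ a, P a) ^ Fintype.card ι := by
  rw [productMass, ← Fintype.prod_sum, Finset.prod_const, Finset.card_univ]

lemma productMass_le_one {P : A → ℝ} (hP : P ∈ stdSimplex ℝ A) (s : Finset (ι → A)) :
    productMass P s ≤ 1 := by
  classical
  simpa only [productMass_univ, hP.2, one_pow] using productMass_mono hP.1 s.subset_univ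

lemma abs_productMass_sub_le_one {P R : A → ℝ} (hP : P ∈ stdSimplex ℝ A)
    (hR : R ∈ stdSimplex ℝ A) (s : Finset (ι → A)) : |productMass P s - productMass R s| ≤ 1 :=
  abs_sub_le_of_nonneg_of_le (productMass_nonneg hP.1 s) (productMass_le_one hP s)
    (productMass_nonneg hR.1 s) (productMass_le_one hR s)

lemma sum_abs_prod_sub_prod_le {P R : A → ℝ} (hP : P ∈ stdSimplex ℝ A)
    (hR : R ∈ stdSimplex ℝ A) (m : ℕ) :
    ∑ y : Fin m → A, |∏ i, P (y i) - ∏ i, R (y i)| ≤ m * ∑ a, |P a - R a| := by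
  induction m with
  | zero => simp
  | succ m ih =>
    have hhead (a : A) (y : Fin m → A) : |P a * ∏ i, P (y i) - R a * ∏ i, R (y i)| ≤
        P a * |∏ i, P (y i) - ∏ i, R (y i)| + |P a - R a| * ∏ i, R (y i) := by
      have hprod : 0 ≤ ∏ i, R (y i) := Finset.prod_nonneg fun i _ => hR.1 _
      calc |P a * ∏ i, P (y i) - R a * ∏ i, R (y i)|
          = |P a * (∏ i, P (y i) - ∏ i, R (y i)) + (P a - R a) * ∏ i, R (y i)| := by
            congr 1; ring
        _ ≤ _ := by
            refine (abs_add_le _ _).trans_eq ?_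
            rw [abs_mul, abs_mul, abs_of_nonneg (hP.1 a), abs_of_nonneg hprod]
    have hone : ∑ y : Fin m → A, ∏ i, R (y i) = 1 := by
      rw [← Fintype.sum_pow, hR.2, one_pow]
    rw [← (Fin.consEquiv fun _ => A).sum_comp, Fintype.sum_prod_type]
    simp only [Fin.consEquiv_apply, Fin.prod_univ_succ, Fin.cons_zero, Fin.cons_succ]
    calc _ ≤ ∑ a, ∑ y : Fin m → A,
          (P a * |∏ i, P (y i) - ∏ i, R (y i)| + |P a - R a| * ∏ i, R (y i)) :=
          Finset.sum_le_sum fun a _ => Finset.sum_le_sum fun y _ => hhead a y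
      _ = (∑ y : Fin m → A, |∏ i, P (y i) - ∏ i, R (y i)|) + ∑ a, |P a - R a| := by
          simp_rw [Finset.sum_add_distrib, ← Finset.mul_sum, hone, mul_one]
          rw [← Finset.sum_mul, hP.2, one_mul]
      _ ≤ _ := by
          push_cast
          linarith

lemma abs_productMass_sub_le {P R : A → ℝ} (hP : P ∈ stdSimplex ℝ A) (hR : R ∈ stdSimplex ℝ A)
    {m : ℕ} (s : Finset (Fin m → A)) :
    |productMass P s - productMass R s| ≤ m * ∑ a, |P a - R a| := by
  rw [productMass, productMass, ← Finset.sum_sub_distrib]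
  calc |∑ y ∈ s, (∏ i, P (y i) - ∏ i, R (y i))| ≤ ∑ y ∈ s, |∏ i, P (y i) - ∏ i, R (y i)| :=
        Finset.abs_sum_le_sum_abs _ _
    _ ≤ ∑ y : Fin m → A, |∏ i, P (y i) - ∏ i, R (y i)| :=
        Finset.sum_le_univ_sum_of_nonneg fun _ => abs_nonneg _
    _ ≤ m * ∑ a, |P a - R a| := sum_abs_prod_sub_prod_le hP hR m

variable [DecidableEq ι] [DecidableEq A]

lemma productMass_typeClass (P : A → ℝ) (x : ι → A) :
    productMass P (typeClass x) = (typeClass x).card * ∏ a, P a ^ occurrences x a := by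
  calc productMass P (typeClass x) = ∑ _y ∈ typeClass x, ∏ a, P a ^ occurrences x a :=
        Finset.sum_congr rfl fun y hy => by
          rw [prod_comp_eq_prod_pow_occurrences, mem_typeClass.1 hy]
    _ = (typeClass x).card * ∏ a, P a ^ occurrences x a := by
        rw [Finset.sum_const, nsmul_eq_mul]

lemma productMass_occurrences_typeClass_le (x y : ι → A) :
    productMass (fun a => (occurrences x a : ℝ)) (typeClass y) ≤
      productMass (fun a => (occurrences x a : ℝ)) (typeClass x) := by
  rw [productMass_typeClass, productMass_typeClass]
  norm_cast
  set F : (ι → A) → ℕ := fun z => ∏ a, (occurrences z a).factorial with hF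
  have hFpos (z : ι → A) : 0 < F z := Finset.prod_pos fun a _ => Nat.factorial_pos _
  have hletter : F x * ∏ a, occurrences x a ^ occurrences y a ≤
      F y * ∏ a, occurrences x a ^ occurrences x a := by
    simp only [hF, ← Finset.prod_mul_distrib]
    exact Finset.prod_le_prod' fun a _ => factorial_mul_pow_le _ _
  have hcard : (typeClass y).card * F y = (typeClass x).card * F x := by
    rw [card_typeClass_mul_prod_factorial, card_typeClass_mul_prod_factorial]
  refine Nat.le_of_mul_le_mul_left (c := F x) ?_ (hFpos x)
  calc F x * ((typeClass y).card * ∏ a, occurrences x a ^ occurrences y a)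
      = (typeClass y).card * (F x * ∏ a, occurrences x a ^ occurrences y a) := by ring
    _ ≤ (typeClass y).card * (F y * ∏ a, occurrences x a ^ occurrences x a) := by gcongr
    _ = F x * ((typeClass x).card * ∏ a, occurrences x a ^ occurrences x a) := by
        rw [← mul_assoc, hcard]; ring

end ProductMass

section Empirical

variable {k n : ℕ}

lemma empirical_eq_smul_occurrences (x : Fin n → Fin k) :
    empirical x = (n : ℝ)⁻¹ • fun a => (occurrences x a : ℝ) :=
  funext fun _ => div_eq_inv_mul _ _

lemma empirical_mem_stdSimplex (hn : 0 < n) (x : Fin n → Fin k) :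
    empirical x ∈ stdSimplex ℝ (Fin k) := by
  have hn0 : (n : ℝ) ≠ 0 := by positivity
  refine ⟨fun a => div_nonneg (Nat.cast_nonneg _) (Nat.cast_nonneg _), ?_⟩
  simp only [empirical_eq_smul_occurrences, Pi.smul_apply, smul_eq_mul]
  rw [← Finset.mul_sum, ← Nat.cast_sum, sum_occurrences, Fintype.card_fin, inv_mul_cancel₀ hn0]

lemma empirical_apply_pos (x : Fin n → Fin k) (i : Fin n) : 0 < empirical x (x i) := by
  have hn : 0 < n := i.pos
  have hocc : 0 < occurrences x (x i) := Finset.card_pos.2 ⟨i, by simp⟩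
  rw [empirical_eq_smul_occurrences, Pi.smul_apply, smul_eq_mul]
  positivity

lemma empirical_eq_of_mem_typeClass {x y : Fin n → Fin k} (hy : y ∈ typeClass x) :
    empirical y = empirical x := by
  rw [empirical_eq_smul_occurrences, empirical_eq_smul_occurrences, mem_typeClass.1 hy]

lemma sum_comp_eq_mul_sum_empirical (f : Fin k → ℝ) (x : Fin n → Fin k) :
    ∑ i, f (x i) = n * ∑ a, empirical x a * f a := by
  rcases Nat.eq_zero_or_pos n with rfl | hn
  · simp
  have hn0 : (n : ℝ) ≠ 0 := by positivity
  rw [← Finset.sum_fiberwise' Finset.univ x f, Finset.mul_sum]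
  refine Finset.sum_congr rfl fun a _ => ?_
  simp only [Finset.sum_const, nsmul_eq_mul, empirical]
  field_simp

lemma prod_comp_eq_exp_mul_prod_comp {P R : Fin k → ℝ} {x : Fin n → Fin k}
    (hP : ∀ i, 0 < P (x i)) (hR : ∀ i, 0 < R (x i)) :
    ∏ i, R (x i) =
      Real.exp (-(n * ∑ a, empirical x a * Real.log (P a / R a))) * ∏ i, P (x i) := by
  rw [← sum_comp_eq_mul_sum_empirical fun a => Real.log (P a / R a), ← Finset.sum_neg_distrib,
    Real.exp_sum, ← Finset.prod_mul_distrib]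
  refine Finset.prod_congr rfl fun i _ => ?_
  rw [← Real.log_inv, inv_div, Real.exp_log (div_pos (hR i) (hP i)), div_mul_cancel₀ _ (hP i).ne']

end Empirical

section MethodOfTypes

variable {k n : ℕ} {R : Fin k → ℝ}

lemma productMass_typeClass_eq_exp_mul (hR : ∀ a, 0 < R a) (x : Fin n → Fin k) :
    productMass R (typeClass x) =
      Real.exp (-(n * kl (empirical x) R)) * productMass (empirical x) (typeClass x) := by
  rw [productMass, productMass, Finset.mul_sum]
  refine Finset.sum_congr rfl fun y hy => ?_
  rw [← empirical_eq_of_mem_typeClass hy]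
  exact prod_comp_eq_exp_mul_prod_comp (empirical_apply_pos y) fun i => hR (y i)

lemma productMass_typeClass_le_exp (hn : 0 < n) (hR : ∀ a, 0 < R a) (x : Fin n → Fin k) :
    productMass R (typeClass x) ≤ Real.exp (-(n * kl (empirical x) R)) := by
  rw [productMass_typeClass_eq_exp_mul hR]
  exact mul_le_of_le_one_right (Real.exp_pos _).le
    (productMass_le_one (empirical_mem_stdSimplex hn x) _)

lemma one_le_pow_mul_productMass_empirical_typeClass (hn : 0 < n) (x : Fin n → Fin k) :
    1 ≤ ((n : ℝ) + 1) ^ k * productMass (empirical x) (typeClass x) := by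
  have hlikeliest (y : Fin n → Fin k) :
      productMass (empirical x) (typeClass y) ≤ productMass (empirical x) (typeClass x) := by
    rw [empirical_eq_smul_occurrences, productMass_smul, productMass_smul]
    gcongr
    exact productMass_occurrences_typeClass_le x y
  calc (1 : ℝ) = productMass (empirical x) (Finset.univ : Finset (Fin n → Fin k)) := by
        rw [productMass_univ, (empirical_mem_stdSimplex hn x).2, one_pow]
    _ ≤ ((n : ℝ) + 1) ^ k * productMass (empirical x) (typeClass x) := by
        have hsum := sum_le_pow_mul_of_sum_typeClass_le
          (f := fun y : Fin n → Fin k => ∏ i, empirical x (y i)) Finset.univ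
          (productMass_nonneg (empirical_mem_stdSimplex hn x).1 (typeClass x)) fun y _ => by
            rw [Finset.filter_univ_mem]
            exact hlikeliest y
        simpa only [Fintype.card_fin] using! hsum

lemma exp_le_pow_mul_productMass_typeClass (hn : 0 < n) (hR : ∀ a, 0 < R a)
    (x : Fin n → Fin k) :
    Real.exp (-(n * kl (empirical x) R)) ≤
      ((n : ℝ) + 1) ^ k * productMass R (typeClass x) := by
  rw [productMass_typeClass_eq_exp_mul hR, mul_left_comm]
  exact le_mul_of_one_le_right (Real.exp_pos _).le
    (one_le_pow_mul_productMass_empirical_typeClass hn x)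

lemma productMass_filter_lt_kl_le (hn : 0 < n) (hR : ∀ a, 0 < R a)
    (S : Finset (Fin n → Fin k)) (δ : ℝ) :
    productMass R {x ∈ S | δ < kl (empirical x) R} ≤
      ((n : ℝ) + 1) ^ k * Real.exp (-(n * δ)) := by
  rw [productMass]
  simpa only [Fintype.card_fin] using sum_le_pow_mul_of_sum_typeClass_le
    {x ∈ S | δ < kl (empirical x) R} (Real.exp_pos _).le fun x hx => by
      calc _ ≤ productMass R (typeClass x) :=
            productMass_mono (fun a => (hR a).le) fun y hy => (Finset.mem_filter.1 hy).2
        _ ≤ Real.exp (-(n * kl (empirical x) R)) := productMass_typeClass_le_exp hn hR x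
        _ ≤ Real.exp (-(n * δ)) := by
            have hδ := (Finset.mem_filter.1 hx).2
            gcongr

end MethodOfTypes

section Divergence

variable {k : ℕ} {P R : Fin k → ℝ}

lemma openSimplex_subset_stdSimplex : openSimplex k ⊆ stdSimplex ℝ (Fin k) :=
  fun _ hP => ⟨fun a => (hP.1 a).le, hP.2⟩

lemma kl_le_sum_sq_div (hP : P ∈ openSimplex k) (hR : R ∈ openSimplex k) :
    kl P R ≤ ∑ a, (P a - R a) ^ 2 / R a := by
  have hterm (a : Fin k) : P a * Real.log (P a / R a) ≤ (P a - R a) ^ 2 / R a + (P a - R a) := by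
    have hPa := hP.1 a
    have hRa := hR.1 a
    calc P a * Real.log (P a / R a) ≤ P a * (P a / R a - 1) := by
          gcongr
          exact Real.log_le_sub_one_of_pos (by positivity)
      _ = (P a - R a) ^ 2 / R a + (P a - R a) := by field_simp; ring
  refine (Finset.sum_le_sum fun a _ => hterm a).trans_eq ?_
  rw [Finset.sum_add_distrib, Finset.sum_sub_distrib, hP.2, hR.2, sub_self, add_zero]

lemma kl_le_mul_norm_sq_div (hP : P ∈ openSimplex k) (hR : R ∈ openSimplex k) {p : ℝ}
    (hp : 0 < p) (hpR : ∀ a, p ≤ R a) : kl P R ≤ k * ‖P - R‖ ^ 2 / p := by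
  calc kl P R ≤ ∑ a, (P a - R a) ^ 2 / R a := kl_le_sum_sq_div hP hR
    _ ≤ ∑ _a : Fin k, ‖P - R‖ ^ 2 / p := by
        refine Finset.sum_le_sum fun a _ => div_le_div₀ (sq_nonneg _) ?_ hp (hpR a)
        rw [← sq_abs]
        gcongr
        exact norm_le_pi_norm (P - R) a
    _ = k * ‖P - R‖ ^ 2 / p := by
        rw [Finset.sum_const, Finset.card_univ, Fintype.card_fin, nsmul_eq_mul, mul_div_assoc]

lemma sq_sqrt_sub_sqrt_le {p r : ℝ} (hp : 0 < p) (hr : 0 < r) :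
    (√p - √r) ^ 2 ≤ p * Real.log (p / r) - p + r := by
  have hlog : Real.log (p / r) = 2 * Real.log (√p / √r) := by
    rw [← Real.sqrt_div' _ hr.le, Real.log_sqrt (div_pos hp hr).le]
    ring
  have htangent : 1 - √r / √p ≤ Real.log (√p / √r) := by
    simpa only [inv_div] using Real.one_sub_inv_le_log_of_pos (x := √p / √r) (by positivity)
  calc (√p - √r) ^ 2 = p * (2 * (1 - √r / √p)) - p + r := by
        have hcross : p * (√r / √p) = √p * √r := by
          rw [mul_div_left_comm, Real.div_sqrt, mul_comm]
        linear_combination Real.sq_sqrt hp.le + Real.sq_sqrt hr.le + 2 * hcross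
    _ ≤ p * Real.log (p / r) - p + r := by
        rw [hlog]
        gcongr

lemma sum_sq_sqrt_sub_sqrt_le_kl (hP : P ∈ openSimplex k) (hR : R ∈ openSimplex k) :
    ∑ a, (√(P a) - √(R a)) ^ 2 ≤ kl P R := by
  calc ∑ a, (√(P a) - √(R a)) ^ 2 ≤ ∑ a, (P a * Real.log (P a / R a) - P a + R a) :=
        Finset.sum_le_sum fun a _ => sq_sqrt_sub_sqrt_le (hP.1 a) (hR.1 a)
    _ = kl P R := by
        rw [Finset.sum_add_distrib, Finset.sum_sub_distrib, hP.2, hR.2, sub_add_cancel, kl]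

-- Cauchy–Schwarz for `|p - r| = |√p - √r| (√p + √r)`.
lemma sum_abs_sub_le_two_mul_sqrt_kl (hP : P ∈ openSimplex k) (hR : R ∈ openSimplex k) :
    ∑ a, |P a - R a| ≤ 2 * √(kl P R) := by
  have hfactor (a : Fin k) : |P a - R a| = |√(P a) - √(R a)| * (√(P a) + √(R a)) := by
    have hsum : 0 ≤ √(P a) + √(R a) := by positivity
    rw [← abs_of_nonneg hsum, ← abs_mul, mul_comm, ← sq_sub_sq, Real.sq_sqrt (hP.1 a).le,
      Real.sq_sqrt (hR.1 a).le]
  have hsum : ∑ a, (√(P a) + √(R a)) ^ 2 ≤ 2 ^ 2 := by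
    calc ∑ a, (√(P a) + √(R a)) ^ 2 ≤ ∑ a, 2 * (P a + R a) := by
          refine Finset.sum_le_sum fun a _ => add_sq_le.trans_eq ?_
          rw [Real.sq_sqrt (hP.1 a).le, Real.sq_sqrt (hR.1 a).le]
      _ = 2 ^ 2 := by
          rw [← Finset.mul_sum, Finset.sum_add_distrib, hP.2, hR.2]
          norm_num
  calc ∑ a, |P a - R a| = ∑ a, |√(P a) - √(R a)| * (√(P a) + √(R a)) :=
        Finset.sum_congr rfl fun a _ => hfactor a
    _ ≤ √(∑ a, |√(P a) - √(R a)| ^ 2) * √(∑ a, (√(P a) + √(R a)) ^ 2) :=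
        Real.sum_mul_le_sqrt_mul_sqrt _ _ _
    _ ≤ √(kl P R) * √(2 ^ 2) := by
        simp only [sq_abs]
        gcongr
        exact sum_sq_sqrt_sub_sqrt_le_kl hP hR
    _ = 2 * √(kl P R) := by rw [Real.sqrt_sq zero_le_two, mul_comm]

end Divergence

section Exchangeable

variable {ι κ A : Type*} [Fintype ι] [DecidableEq ι] [Fintype κ] [Fintype A] [DecidableEq A]
  {w : (ι → A) → ℝ}

lemma sum_filter_comp_mem_eq_of_injective (hw : ∀ x (σ : Equiv.Perm ι), w (x ∘ σ) = w x)
    {j j' : κ → ι} (hj : Function.Injective j) (hj' : Function.Injective j')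
    (s : Finset (κ → A)) : ∑ x with x ∘ j ∈ s, w x = ∑ x with x ∘ j' ∈ s, w x := by
  obtain ⟨σ, hσ⟩ := Equiv.Perm.exists_extending_pair j' j hj' hj
  have hcomp (x : ι → A) : (x ∘ σ) ∘ j' = x ∘ j := funext fun i => congrArg x (hσ i)
  exact Finset.sum_equiv (σ.symm.arrowCongr (Equiv.refl A))
    (fun x => by simp [Equiv.arrowCongr, hcomp]) fun x _ => (hw x σ).symm

-- The left side compares the law of `x ∘ j₀` with the average over all `j` of the laws of `x ∘ j`;
-- by exchangeability only the collisions contribute.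
lemma abs_pow_mul_sum_sub_sum_mul_card_le [DecidableEq κ]
    (hw : ∀ x (σ : Equiv.Perm ι), w (x ∘ σ) = w x)
    (hw0 : 0 ≤ w) {j₀ : κ → ι} (hj₀ : Function.Injective j₀) (s : Finset (κ → A)) :
    |(Fintype.card ι : ℝ) ^ Fintype.card κ * ∑ x with x ∘ j₀ ∈ s, w x -
        ∑ x, w x * (Finset.univ.filter fun j : κ → ι => x ∘ j ∈ s).card| ≤
      (Finset.univ.filter fun j : κ → ι => ¬ Function.Injective j).card * ∑ x, w x := by
  have hmass (j : κ → ι) :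
      0 ≤ ∑ x with x ∘ j ∈ s, w x ∧ ∑ x with x ∘ j ∈ s, w x ≤ ∑ x, w x :=
    ⟨Finset.sum_nonneg fun x _ => hw0 x, Finset.sum_le_univ_sum_of_nonneg hw0⟩
  have hswap : ∑ x, w x * (Finset.univ.filter fun j : κ → ι => x ∘ j ∈ s).card =
      ∑ j : κ → ι, ∑ x with x ∘ j ∈ s, w x := by
    simp only [Finset.sum_filter]
    rw [Finset.sum_comm]
    refine Finset.sum_congr rfl fun x _ => ?_
    rw [← Finset.sum_filter, Finset.sum_const, nsmul_eq_mul, mul_comm]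
  have hconst : (Fintype.card ι : ℝ) ^ Fintype.card κ * ∑ x with x ∘ j₀ ∈ s, w x =
      ∑ _j : κ → ι, ∑ x with x ∘ j₀ ∈ s, w x := by
    rw [Finset.sum_const, Finset.card_univ, Fintype.card_fun, nsmul_eq_mul, Nat.cast_pow]
  have hcollisions : (Finset.univ.filter fun j : κ → ι => ¬ Function.Injective j).card *
      ∑ x, w x = ∑ j : κ → ι, if Function.Injective j then 0 else ∑ x, w x := by
    rw [Finset.sum_ite, Finset.sum_const_zero, zero_add, Finset.sum_const, nsmul_eq_mul]
  rw [hswap, hconst, hcollisions, ← Finset.sum_sub_distrib]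
  refine (Finset.abs_sum_le_sum_abs _ _).trans (Finset.sum_le_sum fun j _ => ?_)
  split_ifs with hj
  · rw [sum_filter_comp_mem_eq_of_injective hw hj₀ hj, sub_self, abs_zero]
  · exact abs_sub_le_of_nonneg_of_le (hmass j₀).1 (hmass j₀).2 (hmass j).1 (hmass j).2

lemma mul_pow_le_mul_descFactorial_add (n m : ℕ) :
    n * n ^ m ≤ n * n.descFactorial m + m ^ 2 * n ^ m := by
  induction m with
  | zero => simp
  | succ m ih =>
    have hstep : n * n.descFactorial m ≤ n.descFactorial (m + 1) + m * n ^ m := by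
      calc n * n.descFactorial m ≤ (n - m + m) * n.descFactorial m := by gcongr; omega
        _ ≤ n.descFactorial (m + 1) + m * n ^ m := by
          rw [add_mul, Nat.descFactorial_succ]
          gcongr
          exact Nat.descFactorial_le_pow n m
    calc n * n ^ (m + 1) = n * (n * n ^ m) := by ring
      _ ≤ n * (n * n.descFactorial m + m ^ 2 * n ^ m) := by gcongr
      _ ≤ n * (n.descFactorial (m + 1) + m * n ^ m + m ^ 2 * n ^ m) := by gcongr
      _ ≤ n * n.descFactorial (m + 1) + (m + 1) ^ 2 * n ^ (m + 1) := by
        rw [pow_succ n m]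
        nlinarith [Nat.zero_le ((m + 1) * (n ^ m * n))]

lemma card_not_injective_le [DecidableEq κ] :
    (Fintype.card ι : ℝ) * (Finset.univ.filter fun j : κ → ι => ¬ Function.Injective j).card ≤
      (Fintype.card κ : ℝ) ^ 2 * (Fintype.card ι : ℝ) ^ Fintype.card κ := by
  have hinj : (Finset.univ.filter fun j : κ → ι => Function.Injective j).card =
      (Fintype.card ι).descFactorial (Fintype.card κ) := by
    rw [← Fintype.card_subtype, Fintype.card_congr (Equiv.subtypeInjectiveEquivEmbedding _ _),
      Fintype.card_embedding_eq]
  have hsplit := Finset.card_filter_add_card_filter_not (s := Finset.univ)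
    fun j : κ → ι => Function.Injective j
  rw [hinj, Finset.card_univ, Fintype.card_fun] at hsplit
  have hbound := mul_pow_le_mul_descFactorial_add (Fintype.card ι) (Fintype.card κ)
  have hcollisions : Fintype.card ι *
      (Finset.univ.filter fun j : κ → ι => ¬ Function.Injective j).card ≤
        Fintype.card κ ^ 2 * Fintype.card ι ^ Fintype.card κ := by
    refine Nat.le_of_add_le_add_left (a := Fintype.card ι *
      (Fintype.card ι).descFactorial (Fintype.card κ)) ?_
    rwa [← mul_add, hsplit]
  exact_mod_cast hcollisions

lemma productMass_empirical [DecidableEq κ] {n k : ℕ} (x : Fin n → Fin k) (s : Finset (κ → Fin k)) :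
    productMass (empirical x) s =
      (Finset.univ.filter fun j : κ → Fin n => x ∘ j ∈ s).card / (n : ℝ) ^ Fintype.card κ := by
  have hfiber (y : κ → Fin k) : ∏ i, empirical x (y i) =
      (Finset.univ.filter fun j : κ → Fin n => x ∘ j = y).card / (n : ℝ) ^ Fintype.card κ := by
    have hpi : (Finset.univ.filter fun j : κ → Fin n => x ∘ j = y) =
        Fintype.piFinset fun i => Finset.univ.filter fun l => x l = y i := by
      ext j
      simp [funext_iff]
    simp only [hpi, Fintype.card_piFinset, empirical, Finset.prod_div_distrib, Finset.prod_const,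
      Finset.card_univ, Nat.cast_prod]
  have hcard : (Finset.univ.filter fun j : κ → Fin n => x ∘ j ∈ s).card =
      ∑ y ∈ s, (Finset.univ.filter fun j : κ → Fin n => x ∘ j = y).card := by
    refine (Finset.card_eq_sum_card_fiberwise (f := fun j : κ → Fin n => x ∘ j) (t := s)
      fun j hj => (Finset.mem_filter.1 hj).2).trans
        (Finset.sum_congr rfl fun y hy => congrArg Finset.card ?_)
    rw [Finset.filter_filter]
    exact Finset.filter_congr fun j _ =>
      and_iff_right_of_imp fun h => by simpa only [h, Finset.mem_coe] using hy
  rw [productMass, hcard, Nat.cast_sum, Finset.sum_div]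
  exact Finset.sum_congr rfl fun y _ => hfiber y

lemma abs_sum_sub_sum_mul_productMass_empirical_le {n k : ℕ} {w : (Fin n → Fin k) → ℝ}
    (hn : 0 < n) (hw : ∀ x (σ : Equiv.Perm (Fin n)), w (x ∘ σ) = w x) (hw0 : 0 ≤ w)
    {j : κ → Fin n} (hj : Function.Injective j) (s : Finset (κ → Fin k)) :
    |∑ x with x ∘ j ∈ s, w x - ∑ x, w x * productMass (empirical x) s| ≤
      (Fintype.card κ : ℝ) ^ 2 / n * ∑ x, w x := by
  classical
  have hn0 : (0 : ℝ) < n := by exact_mod_cast hn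
  have hcoll := card_not_injective_le (ι := Fin n) (κ := κ)
  have havg := abs_pow_mul_sum_sub_sum_mul_card_le hw hw0 hj s
  rw [Fintype.card_fin] at hcoll havg
  have hpow : (0 : ℝ) < (n : ℝ) ^ Fintype.card κ := by positivity
  refine le_of_mul_le_mul_left ?_ hpow
  calc (n : ℝ) ^ Fintype.card κ *
        |∑ x with x ∘ j ∈ s, w x - ∑ x, w x * productMass (empirical x) s|
      = |(n : ℝ) ^ Fintype.card κ * ∑ x with x ∘ j ∈ s, w x -
          ∑ x, w x * (Finset.univ.filter fun j : κ → Fin n => x ∘ j ∈ s).card| := by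
        simp only [productMass_empirical]
        rw [← abs_of_pos hpow, ← abs_mul, abs_of_pos hpow, mul_sub, Finset.mul_sum Finset.univ]
        congr 2
        refine Finset.sum_congr rfl fun x _ => ?_
        field_simp
    _ ≤ _ := havg
    _ ≤ (Fintype.card κ : ℝ) ^ 2 * (n : ℝ) ^ Fintype.card κ / n * ∑ x, w x := by
        refine mul_le_mul_of_nonneg_right ?_ (Finset.sum_nonneg fun x _ => hw0 x)
        rwa [le_div_iff₀' hn0]
    _ = (n : ℝ) ^ Fintype.card κ * ((Fintype.card κ : ℝ) ^ 2 / n * ∑ x, w x) := by ring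

end Exchangeable

section ConditionedProduct

variable {ι A : Type*} [Fintype ι] [DecidableEq A] {P : A → ℝ} {B : Finset (ι → A)}

/-- The mass function of the product of the mass function `P` conditioned on the finite event `B`;
it vanishes identically when `B` has mass zero. -/
noncomputable def condProductMass (P : A → ℝ) (B : Finset (ι → A)) (x : ι → A) : ℝ :=
  if x ∈ B then (∏ i, P (x i)) / productMass P B else 0

lemma condProductMass_nonneg (hP : 0 ≤ P) : 0 ≤ condProductMass P B := by
  intro x
  unfold condProductMass
  split_ifs
  · exact div_nonneg (Finset.prod_nonneg fun i _ => hP _) (productMass_nonneg hP B)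
  · exact le_rfl

lemma condProductMass_congr {R : A → ℝ} {c : ℝ} (hc : c ≠ 0)
    (h : ∀ x ∈ B, ∏ i, R (x i) = c * ∏ i, P (x i)) :
    condProductMass R B = condProductMass P B := by
  have hmass : productMass R B = c * productMass P B := by
    rw [productMass, productMass, Finset.mul_sum, Finset.sum_congr rfl h]
  funext x
  refine if_ctx_congr Iff.rfl (fun hx => ?_) fun _ => rfl
  rw [h x hx, hmass, mul_div_mul_left _ _ hc]

variable [Fintype A] [DecidableEq ι]

lemma sum_filter_condProductMass (P : A → ℝ) (B : Finset (ι → A)) (c : (ι → A) → Prop)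
    [DecidablePred c] :
    ∑ x with c x, condProductMass P B x =
      productMass P {x ∈ B | c x} / productMass P B := by
  simp only [condProductMass]
  have hfilter : (Finset.univ.filter c).filter (· ∈ B) = B.filter c := by
    ext x
    simp [and_comm]
  rw [← Finset.sum_filter, hfilter, ← Finset.sum_div]
  rfl

lemma sum_condProductMass (hB : productMass P B ≠ 0) : ∑ x, condProductMass P B x = 1 := by
  simpa only [Finset.filter_true, div_self hB] using
    sum_filter_condProductMass P B fun _ => True

lemma condProductMass_comp_perm (hB : ∀ x ∈ B, typeClass x ⊆ B) (x : ι → A)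
    (σ : Equiv.Perm ι) : condProductMass P B (x ∘ σ) = condProductMass P B x := by
  have hocc : occurrences (x ∘ σ) = occurrences x := (exists_comp_perm_eq_iff x _).1 ⟨σ, rfl⟩
  have hmem : x ∘ σ ∈ B ↔ x ∈ B :=
    ⟨fun h => hB _ h (mem_typeClass.2 hocc.symm), fun h => hB _ h (mem_typeClass.2 hocc)⟩
  have hprod : ∏ i, P ((x ∘ σ) i) = ∏ i, P (x i) := Equiv.prod_comp σ fun i => P (x i)
  simp only [condProductMass, hmem, hprod]

end ConditionedProduct

section GibbsConditioning

variable {k n m : ℕ} {P : Fin k → ℝ} {B : Finset (Fin n → Fin k)} {x₀ : Fin n → Fin k}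

lemma sum_filter_lt_kl_condProductMass_le (hn : 0 < n) (hP : ∀ a, 0 < P a)
    (hx₀ : typeClass x₀ ⊆ B) (δ : ℝ) :
    ∑ x with δ < kl (empirical x) P, condProductMass P B x ≤
      ((n : ℝ) + 1) ^ (2 * k) * Real.exp (n * (kl (empirical x₀) P - δ)) := by
  have hP0 : 0 ≤ P := fun a => (hP a).le
  have hlower : Real.exp (-(n * kl (empirical x₀) P)) ≤
      ((n : ℝ) + 1) ^ k * productMass P B :=
    (exp_le_pow_mul_productMass_typeClass hn hP x₀).trans <| by
      gcongr
      exact productMass_mono hP0 hx₀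
  have hmass : 0 < productMass P B :=
    pos_of_mul_pos_right ((Real.exp_pos _).trans_le hlower) (by positivity)
  rw [sum_filter_condProductMass, div_le_iff₀ hmass]
  calc productMass P {x ∈ B | δ < kl (empirical x) P}
      ≤ ((n : ℝ) + 1) ^ k * Real.exp (-(n * δ)) := productMass_filter_lt_kl_le hn hP B δ
    _ = ((n : ℝ) + 1) ^ k * (Real.exp (n * (kl (empirical x₀) P - δ)) *
          Real.exp (-(n * kl (empirical x₀) P))) := by
        rw [← Real.exp_add]
        congr 2
        ring
    _ ≤ ((n : ℝ) + 1) ^ k * (Real.exp (n * (kl (empirical x₀) P - δ)) *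
          (((n : ℝ) + 1) ^ k * productMass P B)) := by gcongr
    _ = _ := by ring

lemma sum_condProductMass_mul_abs_productMass_empirical_sub_le (hP : P ∈ openSimplex k)
    (hB : ∀ x ∈ B, empirical x ∈ openSimplex k) (s : Finset (Fin m → Fin k)) (δ : ℝ) :
    ∑ x, condProductMass P B x * |productMass (empirical x) s - productMass P s| ≤
      m * (2 * √δ) * ∑ x, condProductMass P B x +
        ∑ x with δ < kl (empirical x) P, condProductMass P B x := by
  have hw := condProductMass_nonneg (B := B) (openSimplex_subset_stdSimplex hP).1
  rw [Finset.mul_sum, Finset.sum_filter, ← Finset.sum_add_distrib]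
  refine Finset.sum_le_sum fun x _ => ?_
  by_cases hx : x ∈ B
  swap
  · simp [condProductMass, hx]
  have hPs := openSimplex_subset_stdSimplex hP
  have hxs := openSimplex_subset_stdSimplex (hB x hx)
  split_ifs with hδ
  · exact le_add_of_nonneg_of_le (mul_nonneg (by positivity) (hw x))
      (mul_le_of_le_one_right (hw x) (abs_productMass_sub_le_one hxs hPs s))
  · rw [add_zero, mul_comm]
    refine mul_le_mul_of_nonneg_right ?_ (hw x)
    calc |productMass (empirical x) s - productMass P s|
        ≤ m * ∑ a, |empirical x a - P a| := abs_productMass_sub_le hxs hPs s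
      _ ≤ m * (2 * √(kl (empirical x) P)) := by
          gcongr
          exact sum_abs_sub_le_two_mul_sqrt_kl (hB x hx) hP
      _ ≤ m * (2 * √δ) := by
          gcongr
          exact not_lt.1 hδ

lemma abs_sum_condProductMass_sub_productMass_le (hn : 0 < n) (hP : P ∈ openSimplex k)
    (hB : ∀ x ∈ B, typeClass x ⊆ B) (hB' : ∀ x ∈ B, empirical x ∈ openSimplex k)
    (hx₀ : x₀ ∈ B) {j : Fin m → Fin n} (hj : Function.Injective j)
    (s : Finset (Fin m → Fin k)) (δ : ℝ) :
    |∑ x with x ∘ j ∈ s, condProductMass P B x - productMass P s| ≤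
      (m : ℝ) ^ 2 / n + (m * (2 * √δ) +
        ((n : ℝ) + 1) ^ (2 * k) * Real.exp (n * (kl (empirical x₀) P - δ))) := by
  set w := condProductMass P B
  have hw : 0 ≤ w := condProductMass_nonneg (openSimplex_subset_stdSimplex hP).1
  have hone : ∑ x, w x = 1 :=
    sum_condProductMass (Finset.sum_pos (fun x _ => Finset.prod_pos fun i _ => hP.1 (x i))
      ⟨x₀, hx₀⟩).ne'
  have hreplace : |∑ x with x ∘ j ∈ s, w x - ∑ x, w x * productMass (empirical x) s| ≤
      (m : ℝ) ^ 2 / n := by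
    simpa only [hone, mul_one, Fintype.card_fin] using
      abs_sum_sub_sum_mul_productMass_empirical_le (w := w) hn (condProductMass_comp_perm hB)
        hw hj s
  have hconcentrate : |∑ x, w x * productMass (empirical x) s - productMass P s| ≤
      m * (2 * √δ) + ((n : ℝ) + 1) ^ (2 * k) * Real.exp (n * (kl (empirical x₀) P - δ)) := by
    calc |∑ x, w x * productMass (empirical x) s - productMass P s|
        = |∑ x, w x * (productMass (empirical x) s - productMass P s)| := by
          simp only [mul_sub, Finset.sum_sub_distrib, ← Finset.sum_mul, hone, one_mul]
      _ ≤ ∑ x, w x * |productMass (empirical x) s - productMass P s| := by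
          refine (Finset.abs_sum_le_sum_abs _ _).trans_eq (Finset.sum_congr rfl fun x _ => ?_)
          rw [abs_mul, abs_of_nonneg (hw x)]
      _ ≤ _ := by
          refine (sum_condProductMass_mul_abs_productMass_empirical_sub_le hP hB' s δ).trans ?_
          rw [hone, mul_one]
          gcongr
          exact sum_filter_lt_kl_condProductMass_le hn hP.1 (hB x₀ hx₀) δ
  exact (abs_sub_le _ _ _).trans (add_le_add hreplace hconcentrate)

end GibbsConditioning

section Rounding

lemma exists_forall_mem_span_exists_norm_sub_le {E : Type*} [NormedAddCommGroup E]
    [NormedSpace ℝ E] [FiniteDimensional ℝ E] (L : AddSubgroup E) :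
    ∃ K : ℝ, ∀ v ∈ Submodule.span ℝ (L : Set E), ∃ w ∈ L, ‖w - v‖ ≤ K := by
  obtain ⟨B, hBL, hspan⟩ := (Submodule.fg_span_iff_fg_span_finset_subset (L : Set E)).1
    (IsNoetherian.noetherian (Submodule.span ℝ (L : Set E)))
  refine ⟨∑ b ∈ B, ‖b‖, fun v hv => ?_⟩
  rw [hspan] at hv
  obtain ⟨c, -, rfl⟩ := Submodule.mem_span_finset.1 hv
  refine ⟨∑ b ∈ B, ⌊c b⌋ • b, sum_mem fun b hb => zsmul_mem (hBL hb) _, ?_⟩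
  rw [← Finset.sum_sub_distrib]
  refine norm_sum_le_of_le _ fun b _ => ?_
  calc ‖⌊c b⌋ • b - c b • b‖ = |Int.fract (c b)| * ‖b‖ := by
        rw [← Int.cast_smul_eq_zsmul ℝ, ← sub_smul, norm_smul, Real.norm_eq_abs, abs_sub_comm,
          Int.self_sub_floor]
    _ ≤ ‖b‖ := by
        rw [Int.abs_fract]
        exact mul_le_of_le_one_left (norm_nonneg b) (Int.fract_lt_one _).le

end Rounding

section FeasibleTypes

variable {k d n : ℕ} {h : Fin k → Fin d → ℝ} {α : Fin d → ℝ} {P : Fin k → ℝ}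

/-- The linear map whose fibre over `(1, α)` is the affine hull of the feasible laws and whose
kernel consists of the tangent vectors. -/
def momentMap (h : Fin k → Fin d → ℝ) : (Fin k → ℝ) →ₗ[ℝ] ℝ × (Fin d → ℝ) :=
  Fintype.linearCombination ℝ fun a => (1, h a)

lemma momentMap_apply (h : Fin k → Fin d → ℝ) (v : Fin k → ℝ) :
    momentMap h v = (∑ a, v a, ∑ a, v a • h a) := by
  simp [momentMap, Fintype.linearCombination_apply, Prod.ext_iff, Prod.fst_sum, Prod.snd_sum]

lemma mem_feasible_iff : P ∈ feasible h α ↔ (∀ a, 0 < P a) ∧ momentMap h P = (1, α) := by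
  rw [momentMap_apply, Prod.mk.injEq, ← and_assoc]
  rfl

/-- The lattice of integral tangent vectors, along which a type of sample size `n` is moved, in
steps of `1 / n`, without changing its moments. -/
def integralTangents (h : Fin k → Fin d → ℝ) : AddSubgroup (Fin k → ℝ) :=
  (LinearMap.ker (momentMap h)).toAddSubgroup ⊓
    AddSubgroup.pi Set.univ fun _ => (Int.castAddHom ℝ).range

lemma mem_integralTangents {v : Fin k → ℝ} :
    v ∈ integralTangents h ↔ momentMap h v = 0 ∧ ∀ a, ∃ z : ℤ, (z : ℝ) = v a := by
  simp [integralTangents, AddSubgroup.mem_pi, AddSubgroup.mem_zmultiples_iff]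

lemma pos_of_mem_feasibleTypes (hP : P ∈ feasibleTypes h α n) : 0 < n := by
  obtain ⟨⟨⟨-, hsum⟩, -⟩, x, rfl⟩ := hP
  refine Nat.pos_of_ne_zero fun hn => ?_
  subst hn
  simp [empirical] at hsum

lemma sub_mem_span_integralTangents {n' : ℕ} {P' : Fin k → ℝ} (hP : P ∈ feasibleTypes h α n)
    (hP' : P' ∈ feasibleTypes h α n') :
    P - P' ∈ Submodule.span ℝ (integralTangents h : Set (Fin k → ℝ)) := by
  have hn : (n : ℝ) ≠ 0 := Nat.cast_ne_zero.2 (pos_of_mem_feasibleTypes hP).ne'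
  have hn' : (n' : ℝ) ≠ 0 := Nat.cast_ne_zero.2 (pos_of_mem_feasibleTypes hP').ne'
  obtain ⟨hPfeas, x, rfl⟩ := hP
  obtain ⟨hPfeas', x', rfl⟩ := hP'
  have hcleared : ((n : ℝ) * n') • (empirical x - empirical x') ∈ integralTangents h := by
    refine mem_integralTangents.2 ⟨?_, fun a => ⟨occurrences x a * n' - occurrences x' a * n, ?_⟩⟩
    · rw [map_smul, map_sub, (mem_feasible_iff.1 hPfeas).2, (mem_feasible_iff.1 hPfeas').2,
        sub_self, smul_zero]
    · simp only [empirical_eq_smul_occurrences, Pi.smul_apply, Pi.sub_apply, smul_eq_mul]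
      push_cast
      field_simp
  rw [← inv_smul_smul₀ (mul_ne_zero hn hn') (empirical x - empirical x')]
  exact Submodule.smul_mem _ _ (Submodule.subset_span hcleared)

lemma exists_occurrences_eq {c : Fin k → ℕ} (hc : ∑ a, c a = n) :
    ∃ x : Fin n → Fin k, occurrences x = c := by
  subst hc
  refine ⟨fun i => (finSigmaFinEquiv.symm i).1, funext fun a => ?_⟩
  calc occurrences (fun i => (finSigmaFinEquiv.symm i).1) a
      = Fintype.card {i // (finSigmaFinEquiv.symm i).1 = a} := (Fintype.card_subtype _).symm
    _ = Fintype.card {i : (a : Fin k) × Fin (c a) // i.1 = a} :=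
        Fintype.card_congr (finSigmaFinEquiv.symm.subtypeEquiv fun _ => Iff.rfl)
    _ = c a := by
        rw [Fintype.card_congr (Equiv.sigmaSubtype a), Fintype.card_fin]

lemma exists_empirical_eq (hn : 0 < n) (hP : P ∈ openSimplex k)
    (hint : ∀ a, ∃ z : ℤ, (z : ℝ) = n * P a) : ∃ x : Fin n → Fin k, empirical x = P := by
  have hn0 : (0 : ℝ) < n := by exact_mod_cast hn
  have hnat (a : Fin k) : ∃ c : ℕ, (c : ℝ) = n * P a := by
    obtain ⟨z, hz⟩ := hint a
    have hz0 : 0 ≤ z := by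
      exact_mod_cast hz.symm ▸ (mul_pos hn0 (hP.1 a)).le
    exact ⟨z.toNat, by rw [← hz]; exact_mod_cast Int.toNat_of_nonneg hz0⟩
  choose c hc using hnat
  have hsum : ∑ a, c a = n := by
    have hreal : ((∑ a, c a : ℕ) : ℝ) = n := by
      rw [Nat.cast_sum, Finset.sum_congr rfl fun a _ => hc a, ← Finset.mul_sum, hP.2, mul_one]
    exact_mod_cast hreal
  obtain ⟨x, rfl⟩ := exists_occurrences_eq hsum
  refine ⟨x, funext fun a => ?_⟩
  rw [empirical_eq_smul_occurrences, Pi.smul_apply, smul_eq_mul, hc, inv_mul_cancel_left₀ hn0.ne']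

lemma minMass_le (P : Fin k → ℝ) (a : Fin k) : minMass P ≤ P a :=
  ciInf_le (Set.finite_range P).bddBelow a

lemma exists_minMass_eq (hP : P ∈ openSimplex k) : ∃ a, P a = minMass P := by
  have hne : Nonempty (Fin k) := by
    by_contra hempty
    rw [not_nonempty_iff] at hempty
    simpa using hP.2
  exact exists_eq_ciInf_of_finite

lemma minMass_pos (hP : P ∈ openSimplex k) : 0 < minMass P := by
  obtain ⟨a, ha⟩ := exists_minMass_eq hP
  exact ha ▸ hP.1 a

lemma minMass_le_one (hP : P ∈ openSimplex k) : minMass P ≤ 1 := by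
  obtain ⟨a, ha⟩ := exists_minMass_eq hP
  exact ha ▸ (mem_Icc_of_mem_stdSimplex (openSimplex_subset_stdSimplex hP) a).2

lemma norm_sub_le_one_of_mem_stdSimplex {ι : Type*} [Fintype ι] {P R : ι → ℝ}
    (hP : P ∈ stdSimplex ℝ ι) (hR : R ∈ stdSimplex ℝ ι) : ‖P - R‖ ≤ 1 :=
  (pi_norm_le_iff_of_nonneg zero_le_one).2 fun a =>
    abs_sub_le_of_nonneg_of_le (hP.1 a) (mem_Icc_of_mem_stdSimplex hP a).2 (hR.1 a)
      (mem_Icc_of_mem_stdSimplex hR a).2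

lemma sub_mem_span_integralTangents_of_mem_closure {P₀ : Fin k → ℝ}
    (hP : P ∈ closure (⋃ n, feasibleTypes h α n)) (hP₀ : P₀ ∈ feasibleTypes h α n) :
    P - P₀ ∈ Submodule.span ℝ (integralTangents h : Set (Fin k → ℝ)) := by
  let V := Submodule.span ℝ (integralTangents h : Set (Fin k → ℝ))
  have hclosed : IsClosed {R | R - P₀ ∈ V} :=
    V.closed_of_finiteDimensional.preimage (continuous_id.sub continuous_const)
  have hsub : ⋃ n, feasibleTypes h α n ⊆ {R | R - P₀ ∈ V} :=
    Set.iUnion_subset fun _ _ hR => sub_mem_span_integralTangents hR hP₀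
  exact closure_minimal hsub hclosed hP

lemma exists_empirical_eq_add_smul {x₀ : Fin n → Fin k} {w : Fin k → ℝ} (hn : 0 < n)
    (hx₀ : empirical x₀ ∈ feasible h α) (hw : w ∈ integralTangents h)
    (hpos : ∀ a, 0 < (empirical x₀ + (n : ℝ)⁻¹ • w) a) :
    ∃ x : Fin n → Fin k, empirical x = empirical x₀ + (n : ℝ)⁻¹ • w ∧
      empirical x ∈ feasible h α := by
  obtain ⟨hwker, hwint⟩ := mem_integralTangents.1 hw
  have hfeas : empirical x₀ + (n : ℝ)⁻¹ • w ∈ feasible h α := by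
    refine mem_feasible_iff.2 ⟨hpos, ?_⟩
    rw [map_add, map_smul, hwker, smul_zero, add_zero, (mem_feasible_iff.1 hx₀).2]
  obtain ⟨x, hx⟩ := exists_empirical_eq hn hfeas.1 fun a => by
    obtain ⟨z, hz⟩ := hwint a
    refine ⟨occurrences x₀ a + z, ?_⟩
    simp only [empirical_eq_smul_occurrences, Pi.add_apply, Pi.smul_apply, smul_eq_mul, ← hz]
    push_cast
    field_simp
  exact ⟨x, hx, hx ▸ hfeas⟩

-- From any feasible type the displacement to `P` is rounded in the lattice of integral tangents;
-- only positivity of the result can fail, and then `n` is bounded.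
lemma exists_forall_exists_norm_empirical_sub_le (hP : P ∈ feasible h α)
    (hclosure : P ∈ closure (⋃ n, feasibleTypes h α n)) :
    ∃ K : ℝ, ∀ n, (feasibleTypes h α n).Nonempty →
      ∃ x : Fin n → Fin k, empirical x ∈ feasible h α ∧ ‖empirical x - P‖ ≤ K / n := by
  obtain ⟨K, hround⟩ := exists_forall_mem_span_exists_norm_sub_le (integralTangents h)
  refine ⟨max K (K / minMass P), fun n ⟨P₀, hP₀⟩ => ?_⟩
  have hn := pos_of_mem_feasibleTypes hP₀
  have hn0 : (0 : ℝ) < n := by exact_mod_cast hn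
  obtain ⟨w, hwL, hw⟩ := hround _
    (Submodule.smul_mem _ (n : ℝ) (sub_mem_span_integralTangents_of_mem_closure hclosure hP₀))
  obtain ⟨hx₀, x₀, rfl⟩ := hP₀
  set R := empirical x₀ + (n : ℝ)⁻¹ • w with hR
  have hnear : ‖R - P‖ ≤ K / n := by
    have hsub : R - P = (n : ℝ)⁻¹ • (w - (n : ℝ) • (P - empirical x₀)) := by
      rw [smul_sub, inv_smul_smul₀ hn0.ne', hR]
      abel
    rw [hsub, norm_smul, norm_inv, Real.norm_natCast, ← div_eq_inv_mul]
    gcongr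
  by_cases hpos : ∀ a, 0 < R a
  · obtain ⟨x, hxR, hx⟩ := exists_empirical_eq_add_smul hn hx₀ hwL hpos
    refine ⟨x, hx, ?_⟩
    rw [hxR]
    refine hnear.trans ?_
    gcongr
    exact le_max_left _ _
  · obtain ⟨a, ha⟩ := not_forall.1 hpos
    have hfar : minMass P ≤ K / n := by
      calc minMass P ≤ P a - R a := by linarith [minMass_le P a]
        _ ≤ ‖R - P‖ := by
          rw [norm_sub_rev]
          exact (le_abs_self _).trans (norm_le_pi_norm (P - R) a)
        _ ≤ K / n := hnear
    refine ⟨x₀, hx₀, (norm_sub_le_one_of_mem_stdSimplex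
      (openSimplex_subset_stdSimplex hx₀.1) (openSimplex_subset_stdSimplex hP.1)).trans ?_⟩
    calc (1 : ℝ) ≤ K / minMass P / n := by
          rwa [div_right_comm, one_le_div (minMass_pos hP.1)]
      _ ≤ max K (K / minMass P) / n := by
          gcongr
          exact le_max_right _ _

end FeasibleTypes

section InfoProjection

variable {k d n : ℕ} {h : Fin k → Fin d → ℝ} {α : Fin d → ℝ} {P Q : Fin k → ℝ}

lemma hasDerivAt_kl_add_smul (hP : ∀ a, 0 < P a) (hQ : ∀ a, 0 < Q a) (v : Fin k → ℝ) :
    HasDerivAt (fun t : ℝ => kl (P + t • v) Q) (∑ a, (v a * Real.log (P a / Q a) + v a)) 0 := by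
  unfold kl
  refine HasDerivAt.fun_sum fun a _ => ?_
  have hPa := (hP a).ne'
  have hQa := (hQ a).ne'
  have hline : HasDerivAt (fun t : ℝ => (P + t • v) a) (v a) 0 := by
    simpa using ((hasDerivAt_id (0 : ℝ)).mul_const (v a)).const_add (P a)
  have hlog := (hline.div_const (Q a)).log (by simpa using div_ne_zero hPa hQa)
  refine (hline.mul hlog).congr_deriv ?_
  simp only [zero_smul, add_zero]
  field_simp

lemma IsInfoProjection.sum_mul_log_eq_zero (hQ : ∀ a, 0 < Q a)
    (hP : IsInfoProjection Q (feasible h α) P) {v : Fin k → ℝ} (hv : momentMap h v = 0) :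
    ∑ a, v a * Real.log (P a / Q a) = 0 := by
  obtain ⟨hPfeas, hmin⟩ := hP
  obtain ⟨hPpos, hPmoment⟩ := mem_feasible_iff.1 hPfeas
  have hpos : ∀ᶠ t : ℝ in nhds 0, ∀ a, 0 < (P + t • v) a := by
    refine eventually_all.2 fun a => ?_
    have hcont : Continuous fun t : ℝ => (P + t • v) a := by fun_prop
    exact hcont.continuousAt.eventually_const_lt (by simpa using hPpos a)
  have hlocal : IsLocalMin (fun t : ℝ => kl (P + t • v) Q) 0 := by
    filter_upwards [hpos] with t ht
    have hfeas : P + t • v ∈ feasible h α :=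
      mem_feasible_iff.2 ⟨ht, by rw [map_add, map_smul, hv, smul_zero, add_zero, hPmoment]⟩
    simpa using hmin _ hfeas
  have hsum : ∑ a, v a = 0 := by
    rw [momentMap_apply] at hv
    exact congrArg Prod.fst hv
  have hcritical := hlocal.hasDerivAt_eq_zero (hasDerivAt_kl_add_smul hPpos hQ v)
  rwa [Finset.sum_add_distrib, hsum, add_zero] at hcritical

lemma IsInfoProjection.prod_comp_eq (hQ : ∀ a, 0 < Q a)
    (hP : IsInfoProjection Q (feasible h α) P) {x : Fin n → Fin k}
    (hx : empirical x ∈ feasible h α) :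
    ∏ i, Q (x i) = Real.exp (-(n * kl P Q)) * ∏ i, P (x i) := by
  have hv : momentMap h (empirical x - P) = 0 := by
    rw [map_sub, (mem_feasible_iff.1 hx).2, (mem_feasible_iff.1 hP.1).2, sub_self]
  have hkl : ∑ a, empirical x a * Real.log (P a / Q a) = kl P Q := by
    have horth := hP.sum_mul_log_eq_zero hQ hv
    simp only [Pi.sub_apply, sub_mul, Finset.sum_sub_distrib] at horth
    exact sub_eq_zero.1 horth
  rw [← hkl]
  exact prod_comp_eq_exp_mul_prod_comp (fun i => hP.1.1.1 (x i)) fun i => hQ (x i)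

open Classical in
/-- The samples of size `n` with feasible empirical distribution. -/
noncomputable def feasibleSamples (h : Fin k → Fin d → ℝ) (α : Fin d → ℝ) (n : ℕ) :
    Finset (Fin n → Fin k) :=
  {x | empirical x ∈ feasible h α}

lemma mem_feasibleSamples {x : Fin n → Fin k} :
    x ∈ feasibleSamples h α n ↔ empirical x ∈ feasible h α := by
  simp [feasibleSamples]

lemma typeClass_subset_feasibleSamples {x : Fin n → Fin k} (hx : x ∈ feasibleSamples h α n) :
    typeClass x ⊆ feasibleSamples h α n := fun y hy => by
  rwa [mem_feasibleSamples, empirical_eq_of_mem_typeClass hy, ← mem_feasibleSamples]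

lemma IsInfoProjection.condProductMass_feasibleSamples (hQ : ∀ a, 0 < Q a)
    (hP : IsInfoProjection Q (feasible h α) P) (n : ℕ) :
    condProductMass Q (feasibleSamples h α n) = condProductMass P (feasibleSamples h α n) :=
  condProductMass_congr (Real.exp_ne_zero (-(n * kl P Q))) fun _ hx =>
    hP.prod_comp_eq hQ (mem_feasibleSamples.1 hx)

end InfoProjection

section Spectrum

variable {k d : ℕ} {h : Fin k → Fin d → ℝ} {P : Fin k → ℝ}

lemma hasEigenvalue_lambdaMin {E : Type*} [NormedAddCommGroup E] [InnerProductSpace ℝ E]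
    [FiniteDimensional ℝ E] [Nontrivial E] {T : Module.End ℝ E} (hT : T.IsSymmetric) :
    T.HasEigenvalue (lambdaMin T) :=
  Set.Nonempty.csInf_mem (s := {μ : ℝ | T.HasEigenvalue μ})
    ⟨_, hT.hasEigenvalue_iInf_of_finiteDimensional⟩ (Module.End.finite_hasEigenvalue T)

lemma diagInv_apply (P : Fin k → ℝ) (v : EuclideanSpace ℝ (Fin k)) (a : Fin k) :
    diagInv P v a = v a / P a := by
  rw [diagInv, Matrix.ofLp_toLpLin, Matrix.toLin'_apply, Matrix.mulVec_diagonal, one_div,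
    div_eq_inv_mul]

lemma inner_projHessian (P : Fin k → ℝ) (v w : tangentSpace h) :
    inner ℝ (projHessian h P v) w = ∑ a, v.1 a * w.1 a / P a := by
  calc inner ℝ (projHessian h P v) w = inner ℝ (diagInv P v.1) w.1 :=
        Submodule.inner_orthogonalProjectionOnto_eq_of_mem_right w _
    _ = ∑ a, v.1 a * w.1 a / P a := by
        simp only [PiLp.inner_apply, diagInv_apply, RCLike.inner_apply, conj_trivial]
        exact Finset.sum_congr rfl fun a _ => by ring

lemma isSymmetric_projHessian (P : Fin k → ℝ) : (projHessian h P).IsSymmetric := by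
  intro v w
  rw [real_inner_comm _ v, inner_projHessian, inner_projHessian]
  exact Finset.sum_congr rfl fun a _ => by rw [mul_comm]

lemma hasEigenvalue_projHessian_mem_Ioc (hP : P ∈ openSimplex k) {μ : ℝ}
    (hμ : (projHessian h P).HasEigenvalue μ) : μ ∈ Set.Ioc 0 (minMass P)⁻¹ := by
  obtain ⟨v, hv⟩ := hμ.exists_hasEigenvector
  have hpos : 0 < ‖v‖ ^ 2 := pow_pos (norm_pos_iff.2 hv.2) 2
  have hnorm : ‖v‖ ^ 2 = ∑ a, v.1 a ^ 2 := by
    rw [Submodule.coe_norm, EuclideanSpace.real_norm_sq_eq]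
  have hrayleigh : μ * ‖v‖ ^ 2 = ∑ a, v.1 a ^ 2 / P a := by
    rw [← real_inner_self_eq_norm_sq, ← real_inner_smul_left, ← hv.apply_eq_smul,
      inner_projHessian]
    exact Finset.sum_congr rfl fun a _ => by rw [sq]
  constructor
  · refine pos_of_mul_pos_left (hpos.trans_le ?_) hpos.le
    rw [hrayleigh, hnorm]
    exact Finset.sum_le_sum fun a _ => le_div_self (sq_nonneg _) (hP.1 a)
      (mem_Icc_of_mem_stdSimplex (openSimplex_subset_stdSimplex hP) a).2
  · refine le_of_mul_le_mul_right ?_ hpos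
    rw [hrayleigh, hnorm, Finset.mul_sum]
    refine Finset.sum_le_sum fun a _ => ?_
    rw [div_eq_inv_mul]
    gcongr
    · exact minMass_pos hP
    · exact minMass_le P a

lemma lambdaMin_projHessian_mem_Ioc (hP : P ∈ openSimplex k) (hT : tangentSpace h ≠ ⊥) :
    lambdaMin (projHessian h P) ∈ Set.Ioc 0 (minMass P)⁻¹ :=
  have := Submodule.nontrivial_iff_ne_bot.2 hT
  hasEigenvalue_projHessian_mem_Ioc hP (hasEigenvalue_lambdaMin (isSymmetric_projHessian P))

end Spectrum

section Measure

lemma tvDist_le {S : Type*} [MeasurableSpace S] [Finite S] {μ ν : Measure S} {c : ℝ}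
    (hc : ∀ s : Finset S, |μ.real s - ν.real s| ≤ c) : tvDist μ ν ≤ c := by
  have : Nonempty {s : Set S // MeasurableSet s} := ⟨⟨∅, MeasurableSet.empty⟩⟩
  refine ciSup_le fun s => ?_
  simpa only [Set.Finite.coe_toFinset] using hc (Set.toFinite s.1).toFinset

lemma tvDist_le_one {S : Type*} [MeasurableSpace S] (μ ν : Measure S)
    [IsZeroOrProbabilityMeasure μ] [IsZeroOrProbabilityMeasure ν] : tvDist μ ν ≤ 1 := by
  have : Nonempty {s : Set S // MeasurableSet s} := ⟨⟨∅, MeasurableSet.empty⟩⟩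
  exact ciSup_le fun s => abs_sub_le_of_nonneg_of_le measureReal_nonneg measureReal_le_one
    measureReal_nonneg measureReal_le_one

variable {k n m : ℕ} {P Q : Fin k → ℝ}

lemma law_singleton (P : Fin k → ℝ) (a : Fin k) : law P {a} = ENNReal.ofReal (P a) := by
  simp [law, Set.indicator_apply]

lemma isProbabilityMeasure_law (hP : P ∈ stdSimplex ℝ (Fin k)) :
    IsProbabilityMeasure (law P) := by
  constructor
  simp only [law, Measure.coe_finsetSum, Finset.sum_apply, Measure.smul_apply, measure_univ,
    smul_eq_mul, mul_one]
  rw [← ENNReal.ofReal_sum_of_nonneg fun a _ => hP.1 a, hP.2, ENNReal.ofReal_one]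

lemma pi_law_real (hP : P ∈ stdSimplex ℝ (Fin k)) (s : Finset (Fin m → Fin k)) :
    (Measure.pi fun _ : Fin m => law P).real s = productMass P s := by
  have := isProbabilityMeasure_law hP
  rw [← sum_measureReal_singleton, productMass]
  refine Finset.sum_congr rfl fun y _ => ?_
  rw [measureReal_def, Measure.pi_singleton, ENNReal.toReal_prod]
  refine Finset.prod_congr rfl fun i _ => ?_
  rw [law_singleton, ENNReal.toReal_ofReal (hP.1 _)]

variable {Ω : Type*} [MeasurableSpace Ω] {Pr : Measure Ω} [IsProbabilityMeasure Pr]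
  {X : ℕ → Ω → Fin k}

lemma IsIIDSample.map_eq_pi (hX : IsIIDSample Pr X Q) (n : ℕ) :
    Pr.map (fun ω (i : Fin n) => X i ω) = Measure.pi fun _ : Fin n => law Q := by
  have hind : iIndepFun (fun i : Fin n => X i) Pr := hX.2.1.precomp Fin.val_injective
  rw [(iIndepFun_iff_map_fun_eq_pi_map fun i : Fin n => (hX.1 i).aemeasurable).1 hind]
  simp only [hX.2.2]

variable {d : ℕ} {h : Fin k → Fin d → ℝ} {α : Fin d → ℝ}

lemma predictiveLaw_real (hQ : Q ∈ stdSimplex ℝ (Fin k)) (hX : IsIIDSample Pr X Q) (hmn : m ≤ n)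
    (s : Finset (Fin m → Fin k)) :
    (predictiveLaw Pr X h α n m).real s =
      ∑ x with x ∘ Fin.castLE hmn ∈ s, condProductMass Q (feasibleSamples h α n) x := by
  let Y (ω : Ω) (i : Fin n) : Fin k := X i ω
  have hY : Measurable Y := measurable_pi_lambda _ fun i => hX.1 i
  have hmass (A : Finset (Fin n → Fin k)) : Pr.real (Y ⁻¹' A) = productMass Q A := by
    rw [← map_measureReal_apply hY A.measurableSet, hX.map_eq_pi n, pi_law_real hQ]
  have hevent : feasibleEvent X h α n = Y ⁻¹' (feasibleSamples h α n) := by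
    ext ω
    simp [feasibleEvent, feasibleTypes, mem_feasibleSamples, Y]
  have hinter : Y ⁻¹' (feasibleSamples h α n) ∩ (fun ω (i : Fin m) => X i ω) ⁻¹' s =
      Y ⁻¹' ({x ∈ feasibleSamples h α n | x ∘ Fin.castLE hmn ∈ s} : Finset (Fin n → Fin k)) := by
    ext ω
    simp only [Set.mem_inter_iff, Set.mem_preimage, Finset.mem_coe, Finset.mem_filter]
    rfl
  have hprefix : Measurable fun ω (i : Fin m) => X i ω := measurable_pi_lambda _ fun i => hX.1 i
  rw [sum_filter_condProductMass, predictiveLaw,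
    map_measureReal_apply hprefix s.measurableSet, hevent,
    measureReal_def, cond_apply (hY (Finset.measurableSet _)), ENNReal.toReal_mul,
    ENNReal.toReal_inv, hinter, ← measureReal_def, ← measureReal_def, hmass, hmass, div_eq_inv_mul]

end Measure

section ConditionalLimit

variable {k d n m : ℕ} {h : Fin k → Fin d → ℝ} {α : Fin d → ℝ} {P Q : Fin k → ℝ}
  {Ω : Type*} [MeasurableSpace Ω] {Pr : Measure Ω} [IsProbabilityMeasure Pr] {X : ℕ → Ω → Fin k}

lemma tvDist_predictiveLaw_le (hQ : Q ∈ openSimplex k)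
    (hP : IsInfoProjection Q (feasible h α) P) (hX : IsIIDSample Pr X Q) (hn : 0 < n)
    {x₀ : Fin n → Fin k} (hx₀ : empirical x₀ ∈ feasible h α) (m : ℕ) (δ : ℝ) :
    tvDist (predictiveLaw Pr X h α n m) (Measure.pi fun _ : Fin m => law P) ≤
      (m : ℝ) ^ 2 / n + (m * (2 * √δ) +
        ((n : ℝ) + 1) ^ (2 * k) * Real.exp (n * (kl (empirical x₀) P - δ))) := by
  have hPs := openSimplex_subset_stdSimplex hP.1.1
  rcases le_or_gt m n with hmn | hnm
  · refine tvDist_le fun s => ?_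
    rw [predictiveLaw_real (openSimplex_subset_stdSimplex hQ) hX hmn, pi_law_real hPs,
      hP.condProductMass_feasibleSamples hQ.1]
    exact abs_sum_condProductMass_sub_productMass_le hn hP.1.1
      (fun _ => typeClass_subset_feasibleSamples) (fun x hx => (mem_feasibleSamples.1 hx).1)
      (mem_feasibleSamples.2 hx₀) (Fin.castLE_injective hmn) s δ
  · have := isProbabilityMeasure_law hPs
    have : IsZeroOrProbabilityMeasure (predictiveLaw Pr X h α n m) := by
      unfold predictiveLaw
      infer_instance
    refine (tvDist_le_one _ _).trans (le_add_of_le_of_nonneg ?_ (by positivity))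
    rw [one_le_div (by positivity)]
    exact_mod_cast hnm.le.trans (Nat.le_self_pow two_ne_zero m)

-- The exponent `2 k + 1` beats the polynomial factor `(n + 1) ^ (2 k)` by one power of `n`.
lemma pow_mul_exp_sub_log_le (hn : 0 < n) (t : ℝ) :
    ((n : ℝ) + 1) ^ (2 * k) * Real.exp (t - (2 * k + 1) * Real.log n) ≤
      4 ^ k * Real.exp t / n := by
  have hn1 : (1 : ℝ) ≤ n := by exact_mod_cast hn
  have hn0 : (0 : ℝ) < n := by exact_mod_cast hn
  have hexp : Real.exp ((2 * k + 1) * Real.log n) = (n : ℝ) ^ (2 * k + 1) := by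
    rw [← Real.exp_log (pow_pos hn0 _), Real.log_pow]
    push_cast
    rfl
  calc ((n : ℝ) + 1) ^ (2 * k) * Real.exp (t - (2 * k + 1) * Real.log n)
      ≤ (2 * n) ^ (2 * k) * (Real.exp t / (n : ℝ) ^ (2 * k + 1)) := by
        rw [Real.exp_sub, hexp]
        gcongr
        linarith
    _ = 4 ^ k * Real.exp t / n := by
        rw [mul_pow, pow_mul 2, pow_succ (n : ℝ), show (2 : ℝ) ^ 2 = 4 by norm_num]
        field_simp

lemma sqrt_mul_div_le {a b p l : ℝ} (ha : 0 ≤ a) (hb : 0 ≤ b) (hp : 0 < p)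
    (hl : l ∈ Set.Ioc 0 p⁻¹) (n : ℕ) : √(a * b / n) ≤ √(a / p) * √(b / (n * l)) := by
  have hpl : p * l ≤ 1 := (mul_le_mul_of_nonneg_left hl.2 hp.le).trans_eq (mul_inv_cancel₀ hp.ne')
  rw [← Real.sqrt_mul (by positivity)]
  refine Real.sqrt_le_sqrt ?_
  calc a * b / n ≤ a * b / n / (p * l) := le_div_self (by positivity) (mul_pos hp hl.1) hpl
    _ = a / p * (b / (n * l)) := by ring

lemma exists_forall_tvDist_predictiveLaw_le (hQ : Q ∈ openSimplex k)
    (hP : IsInfoProjection Q (feasible h α) P)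
    (hclosure : P ∈ closure (⋃ n, feasibleTypes h α n)) :
    ∃ c : ℝ, ∀ (Ω : Type*) [MeasurableSpace Ω] (Pr : Measure Ω) [IsProbabilityMeasure Pr]
      (X : ℕ → Ω → Fin k), IsIIDSample Pr X Q → ∀ n m : ℕ, (feasibleTypes h α n).Nonempty →
        tvDist (predictiveLaw Pr X h α n m) (Measure.pi fun _ : Fin m => law P) ≤
          2 * m * √((2 * k + 1) * Real.log n / n) + (m : ℝ) ^ 2 / n + c / n := by
  obtain ⟨K, hK⟩ := exists_forall_exists_norm_empirical_sub_le hP.1 hclosure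
  set M := k * K ^ 2 / minMass P
  refine ⟨4 ^ k * Real.exp M, fun Ω _ Pr _ X hX n m hne => ?_⟩
  have hn : 0 < n := pos_of_mem_feasibleTypes hne.some_mem
  obtain ⟨x₀, hx₀, hnear⟩ := hK n hne
  have hn1 : (1 : ℝ) ≤ n := by exact_mod_cast hn
  have hp := minMass_pos hP.1.1
  have hkl : n * kl (empirical x₀) P ≤ M := by
    calc n * kl (empirical x₀) P ≤ n * (k * ‖empirical x₀ - P‖ ^ 2 / minMass P) := by
          gcongr
          exact kl_le_mul_norm_sq_div hx₀.1 hP.1.1 hp (minMass_le P)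
      _ ≤ n * (k * (K / n) ^ 2 / minMass P) := by gcongr
      _ = M / n := by
          simp only [M]
          field_simp
      _ ≤ M := div_le_self (by positivity) hn1
  have hexceptional : ((n : ℝ) + 1) ^ (2 * k) *
      Real.exp (n * (kl (empirical x₀) P - (2 * k + 1) * Real.log n / n)) ≤
        4 ^ k * Real.exp M / n := by
    rw [mul_sub, mul_div_cancel₀ _ (by positivity)]
    exact (pow_mul_exp_sub_log_le hn _).trans (by gcongr)
  linarith [tvDist_predictiveLaw_le hQ hP hX hn hx₀ m ((2 * k + 1) * Real.log n / n)]

lemma isLittleO_const_div (c : ℝ) :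
    (fun n : ℕ => c / (n : ℝ)) =o[atTop] fun n : ℕ => (n : ℝ) ^ (-(1 / 2) : ℝ) := by
  have hlim : Tendsto (fun n : ℕ => c * (n : ℝ) ^ (-(1 / 2) : ℝ)) atTop (nhds 0) := by
    simpa using ((tendsto_rpow_neg_atTop (by norm_num : (0 : ℝ) < 1 / 2)).comp
      tendsto_natCast_atTop_atTop).const_mul c
  refine ((isBigO_refl (fun n : ℕ => (n : ℝ) ^ (-(1 / 2) : ℝ)) atTop).mul_isLittleO
    ((isLittleO_one_iff ℝ).2 hlim)).congr' ?_ (by simp)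
  filter_upwards [eventually_gt_atTop 0] with n hn
  rw [mul_left_comm, ← Real.rpow_add (by exact_mod_cast hn),
    show (-(1 / 2) + -(1 / 2) : ℝ) = -1 by norm_num, Real.rpow_neg_one, div_eq_mul_inv]

end ConditionalLimit

end PredictiveCollapse

theorem theorem2_general (k : ℕ) (p : ℝ) :
    ∃ C C' : ℝ, 0 < C ∧ 0 < C' ∧
      ∀ (d : ℕ) (Q : Fin k → ℝ) (h : Fin k → Fin d → ℝ) (α : Fin d → ℝ) (P : Fin k → ℝ),
        Q ∈ openSimplex k →
        tangentSpace h ≠ ⊥ →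
        IsInfoProjection Q (feasible h α) P →
        minMass P = p →
        P ∈ closure (⋃ n, feasibleTypes h α n) →
        ∃ c : ℝ, ∀ (Ω : Type*) [MeasurableSpace Ω] (Pr : Measure Ω) [IsProbabilityMeasure Pr]
          (X : ℕ → Ω → Fin k), IsIIDSample Pr X Q →
        ∀ n m : ℕ, (feasibleTypes h α n).Nonempty →
          tvDist (predictiveLaw Pr X h α n m) (Measure.pi fun _ : Fin m => law P) ≤
            C * m * √(Real.log n / (n * lambdaMin (projHessian h P))) +
            C' * (m : ℝ) ^ 2 / (n * p) + c / n := by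
  rcases le_or_gt p 0 with hp | hp
  · exact ⟨1, 1, one_pos, one_pos, fun d Q h α P _ _ hP hmin =>
      absurd (hmin ▸ minMass_pos hP.1.1) hp.not_gt⟩
  refine ⟨2 * √((2 * k + 1) / p), 1, by positivity, one_pos, ?_⟩
  rintro d Q h α P hQ hT hP rfl hclosure
  obtain ⟨c, hc⟩ := exists_forall_tvDist_predictiveLaw_le hQ hP hclosure
  refine ⟨c, fun Ω _ Pr _ X hX n m hne => (hc Ω Pr X hX n m hne).trans ?_⟩
  have hlead := sqrt_mul_div_le (a := 2 * k + 1) (by positivity) (Real.log_natCast_nonneg n) hp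
    (lambdaMin_projHessian_mem_Ioc hP.1.1 hT) n
  have hquad : (m : ℝ) ^ 2 / n ≤ (m : ℝ) ^ 2 / n / minMass P :=
    le_div_self (by positivity) hp (minMass_le_one hP.1.1)
  calc 2 * m * √((2 * k + 1) * Real.log n / n) + (m : ℝ) ^ 2 / n + c / n
      ≤ 2 * m * (√((2 * k + 1) / minMass P) *
          √(Real.log n / (n * lambdaMin (projHessian h P)))) +
          (m : ℝ) ^ 2 / n / minMass P + c / n := by gcongr
    _ = _ := by ring

theorem theorem2 (k d : ℕ) (hk : 2 ≤ k) (p : ℝ) :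
    ∃ C C' : ℝ, 0 < C ∧ 0 < C' ∧
      ∀ (Q : Fin k → ℝ) (h : Fin k → Fin d → ℝ) (α : Fin d → ℝ) (P : Fin k → ℝ),
        Q ∈ openSimplex k →
        tangentSpace h ≠ ⊥ →
        IsInfoProjection Q (feasible h α) P →
        minMass P = p →
        P ∈ closure (⋃ n, feasibleTypes h α n) →
        ∀ (Ω : Type*) [MeasurableSpace Ω] (Pr : Measure Ω) [IsProbabilityMeasure Pr]
          (X : ℕ → Ω → Fin k), IsIIDSample Pr X Q →
        ∀ m : ℕ → ℕ,
          (fun n => (m n : ℝ)) =o[atTop]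
            (fun n : ℕ => √(n * lambdaMin (projHessian h P) / Real.log n)) →
          ∃ r : ℕ → ℝ, r =o[atTop] (fun n : ℕ => (n : ℝ) ^ (-(1 / 2) : ℝ)) ∧
            ∀ n : ℕ, (feasibleTypes h α n).Nonempty →
              tvDist (predictiveLaw Pr X h α n (m n)) (Measure.pi fun _ : Fin (m n) => law P) ≤
                C * m n * √(Real.log n / (n * lambdaMin (projHessian h P))) +
                C' * (m n : ℝ) ^ 2 / (n * p) + r n := by
  obtain ⟨C, C', hC, hC', hbound⟩ := theorem2_general k p
  refine ⟨C, C', hC, hC', fun Q h α P hQ hT hP hmin hclosure Ω _ Pr _ X hX m _ => ?_⟩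
  obtain ⟨c, hc⟩ := hbound d Q h α P hQ hT hP hmin hclosure
  exact ⟨fun n => c / n, isLittleO_const_div c, fun n => hc Ω Pr X hX n (m n)⟩
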